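/- Let $n\in\mathbb{N}$ and let $\Omega\subset\mathbb{R}^n$ be a (possibly unbounded) open set. For $u:\Omega\to\mathbb{R}$ and $z\in\overline\Omega$ let $$u^*(z)=\limsup_{\Omega\ni y\to z}u(y),\qquad u_*(z)=\liminf_{\Omega\ni y\to z}u(y)\qquad(\text{values in }[-\infty,\infty],\ y=z\text{ allowed}),$$ and let $d_\Omega(x)=\inf_{y\in\partial\Omega}|x-y|$ be the Euclidean distance to $\partial\Omega$ (equal to $+\infty$ if $\partial\Omega=\emptyset$). The function $u$ is a *viscosity subsolution* of $|\nabla u|=1$ in $\Omega$ if $u^*<+\infty$ in $\Omega$ and $|\nabla\phi(x_0)|\le 1$ whenever $\phi\in C^1(\Omega)$, $x_0\in\Omega$, $r>0$, $B_r(x_0)\subset\Omega$, $u^*\le\phi$ on $B_r(x_0)$ and $u^*(x_0)=\phi(x_0)$. It is a *viscosity supersolution* if $u_*>-\infty$ in $\Omega$ and $|\nabla\phi(x_0)|\ge 1$ whenever $\phi\in C^1(\Omega)$, $x_0\in\Omega$, $r>0$, $B_r(x_0)\subset\Omega$, $u_*\ge\phi$ on $B_r(x_0)$ and $u_*(x_0)=\phi(x_0)$.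 Let $u:\Omega\to\mathbb{R}$. 1. If $u$ is a viscosity subsolution of $|\nabla u|=1$ in $\Omega$ and $u^*\le 0$ on $\partial\Omega$, then $u^*\le d_\Omega$ in $\Omega$. 2. If $u$ is a viscosity supersolution of $|\nabla u|=1$ in $\Omega$ and $u\ge 0$ in $\Omega$, then $d_\Omega\le u_*$ in $\Omega$. -/

import Mathlib

open Filter Topology
open scoped ENNReal

noncomputable section

/-- The upper semicontinuous envelope of `f : K → ℝ`, with values in `[-∞, ∞]`:
`f^*(z) = limsup_{y → z, y ∈ K} f(y)`.
It is meaningful for `z` in the closure of `K`. -/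
def upperEnvelope {n : ℕ} {K : Set (EuclideanSpace ℝ (Fin n))} (f : K → ℝ)
    (z : EuclideanSpace ℝ (Fin n)) : EReal :=
  limsup (fun y : K => (f y : EReal)) (comap Subtype.val (𝓝 z))

/-- The lower semicontinuous envelope of `f : K → ℝ`, with values in `[-∞, ∞]`:
`f_*(z) = liminf_{y → z, y ∈ K} f(y)`.
It is meaningful for `z` in the closure of `K`. -/
def lowerEnvelope {n : ℕ} {K : Set (EuclideanSpace ℝ (Fin n))} (f : K → ℝ)
    (z : EuclideanSpace ℝ (Fin n)) : EReal :=
  liminf (fun y : K => (f y : EReal)) (comap Subtype.val (𝓝 z))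

/-- `u : Ω → ℝ` is a (possibly discontinuous) viscosity subsolution of `|∇u| = 1` in `Ω`. -/
def IsEikonalSubsolution {n : ℕ} {Ω : Set (EuclideanSpace ℝ (Fin n))} (u : Ω → ℝ) : Prop :=
  (∀ x ∈ Ω, upperEnvelope u x < ⊤) ∧
  ∀ (φ : EuclideanSpace ℝ (Fin n) → ℝ) (x₀ : EuclideanSpace ℝ (Fin n)) (r : ℝ),
    ContDiffOn ℝ 1 φ Ω → x₀ ∈ Ω → 0 < r → Metric.ball x₀ r ⊆ Ω →
    (∀ y ∈ Metric.ball x₀ r, upperEnvelope u y ≤ (φ y : EReal)) →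
    upperEnvelope u x₀ = (φ x₀ : EReal) →
    ‖gradient φ x₀‖ ≤ 1

/-- `u : Ω → ℝ` is a (possibly discontinuous) viscosity supersolution of `|∇u| = 1` in `Ω`. -/
def IsEikonalSupersolution {n : ℕ} {Ω : Set (EuclideanSpace ℝ (Fin n))} (u : Ω → ℝ) : Prop :=
  (∀ x ∈ Ω, ⊥ < lowerEnvelope u x) ∧
  ∀ (φ : EuclideanSpace ℝ (Fin n) → ℝ) (x₀ : EuclideanSpace ℝ (Fin n)) (r : ℝ),
    ContDiffOn ℝ 1 φ Ω → x₀ ∈ Ω → 0 < r → Metric.ball x₀ r ⊆ Ω →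
    (∀ y ∈ Metric.ball x₀ r, (φ y : EReal) ≤ lowerEnvelope u y) →
    lowerEnvelope u x₀ = (φ x₀ : EReal) →
    1 ≤ ‖gradient φ x₀‖

/-- The distance `inf_{y ∈ ∂Ω} |x - y|` to the boundary, as an extended real number
(it is `+∞` if `∂Ω` is empty). -/
def boundaryDist {n : ℕ} (Ω : Set (EuclideanSpace ℝ (Fin n)))
    (x : EuclideanSpace ℝ (Fin n)) : EReal :=
  ((Metric.infEDist x (frontier Ω) : ℝ≥0∞) : EReal)

end

/-! Both bounds come from comparison with a smooth barrier on a ball centred at `x` inside `Ω`. If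
`φ` is C¹ with gradient norm above 1 everywhere, no translate of `φ` can touch a subsolution from
above, so an inequality on the sphere passes to the centre. Gradient norm below 1 does the same for
supersolutions. For supersolutions the barrier is a downward cone of slope below 1, smoothed at its
vertex. For subsolutions the largest ball around `x` touches the boundary at some `y`. Near `y` the
envelope is nearly nonpositive, while on the rest of the sphere it is only bounded. So the barrier
grows with slope just above 1 from `y` to `x`, plus a large penalty that vanishes on this segment
and never increases in the direction from `x` to `y`. Hence the penalty cannot spoil the gradient
bound. -/

/-! ### Envelopes and comparison on balls -/

theorem upperSemicontinuous_upperEnvelope {n : ℕ} {K : Set (EuclideanSpace ℝ (Fin n))}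
    (f : K → ℝ) : UpperSemicontinuous (upperEnvelope f) := by
  intro z a ha
  obtain ⟨b, hb, hba⟩ := exists_between ha
  have h : ∀ᶠ y : K in comap Subtype.val (𝓝 z), (f y : EReal) < b :=
    eventually_lt_of_limsup_lt hb
  rw [eventually_comap] at h
  filter_upwards [h.eventually_nhds] with w hw
  refine lt_of_le_of_lt ?_ hba
  refine limsup_le_of_le (by isBoundedDefault) ?_
  rw [eventually_comap]
  exact hw.mono fun y hy k hk => (hy k hk).le

theorem upperEnvelope_neg {n : ℕ} {K : Set (EuclideanSpace ℝ (Fin n))}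
    (f : K → ℝ) (z : EuclideanSpace ℝ (Fin n)) :
    upperEnvelope (fun y => -f y) z = -lowerEnvelope f z := by
  simp only [upperEnvelope, lowerEnvelope, EReal.coe_neg]
  exact EReal.limsup_neg

/-- If an upper semicontinuous `f` lies below a continuous `φ` on a sphere but not at the centre,
then some vertical translate of `φ` touches `f` from above inside the ball. -/
theorem UpperSemicontinuous.exists_touching_of_le_sphere {E : Type*} [PseudoMetricSpace E]
    [ProperSpace E] {f : E → EReal} (hf : UpperSemicontinuous f) {φ : E → ℝ} (hφ : Continuous φ)
    {x : E} {r : ℝ} (hr : 0 < r) (hfin : ∀ z ∈ Metric.ball x r, f z < ⊤)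
    (hs : ∀ z ∈ Metric.sphere x r, f z ≤ (φ z : EReal)) (hx : (φ x : EReal) < f x) :
    ∃ z ∈ Metric.ball x r, ∃ c : ℝ, f z = ((φ z + c : ℝ) : EReal) ∧
      ∀ y ∈ Metric.ball x r, f y ≤ ((φ y + c : ℝ) : EReal) := by
  have husc : UpperSemicontinuous (fun z => f z + ((-φ z : ℝ) : EReal)) := by
    refine hf.add' ?_ fun z => EReal.continuousAt_add (.inr (EReal.coe_ne_bot _))
      (.inr (EReal.coe_ne_top _))
    exact (continuous_coe_real_ereal.comp hφ.neg).upperSemicontinuous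
  obtain ⟨z, hz, hmax⟩ := (husc.upperSemicontinuousOn (Metric.closedBall x r)).exists_isMaxOn
    ⟨x, Metric.mem_closedBall_self hr.le⟩ (isCompact_closedBall x r)
  have hpos : 0 < f z + ((-φ z : ℝ) : EReal) := by
    refine lt_of_lt_of_le ?_ (hmax (Metric.mem_closedBall_self hr.le))
    change 0 < f x + ((-φ x : ℝ) : EReal)
    rw [EReal.coe_neg, ← sub_eq_add_neg]
    exact EReal.sub_pos.2 hx
  have hzb : z ∈ Metric.ball x r := by
    rcases (Metric.mem_closedBall.1 hz).lt_or_eq with h | h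
    · exact h
    · rw [EReal.coe_neg, ← sub_eq_add_neg, EReal.sub_pos] at hpos
      exact absurd hpos (hs z h).not_gt
  have hlt := hfin z hzb
  have hbot : f z ≠ ⊥ := by
    intro h
    simp [h] at hpos
  lift f z to ℝ using ⟨hlt.ne, hbot⟩ with a ha
  refine ⟨z, hzb, a - φ z, by rw [← ha]; congr 1; ring, fun y hy => ?_⟩
  have h := hmax (Metric.ball_subset_closedBall hy)
  change f y + ((-φ y : ℝ) : EReal) ≤ f z + ((-φ z : ℝ) : EReal) at h
  rw [← ha] at h
  have hty := hfin y hy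
  induction hfy : f y with
  | bot => exact bot_le
  | top => exact absurd hfy hty.ne
  | coe b =>
    rw [hfy, ← EReal.coe_add, ← EReal.coe_add, EReal.coe_le_coe_iff] at h
    rw [EReal.coe_le_coe_iff]
    linarith

theorem gradient_add_const {F : Type*} [NormedAddCommGroup F] [InnerProductSpace ℝ F]
    [CompleteSpace F] (φ : F → ℝ) (c : ℝ) (z : F) :
    gradient (fun y => φ y + c) z = gradient φ z := by
  simp [gradient, fderiv_add_const]

/-- Otherwise a translate of `φ` would touch the envelope from above inside the ball, and
translation does not change the gradient. -/
theorem IsEikonalSubsolution.le_of_le_sphere {n : ℕ} {Ω : Set (EuclideanSpace ℝ (Fin n))}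
    {u : Ω → ℝ} (hu : IsEikonalSubsolution u) {φ : EuclideanSpace ℝ (Fin n) → ℝ}
    (hφ : ContDiff ℝ 1 φ) {x : EuclideanSpace ℝ (Fin n)} {r : ℝ} (hr : 0 < r)
    (hball : Metric.ball x r ⊆ Ω) (hgrad : ∀ z, 1 < ‖gradient φ z‖)
    (hs : ∀ z ∈ Metric.sphere x r, upperEnvelope u z ≤ (φ z : EReal)) :
    upperEnvelope u x ≤ (φ x : EReal) := by
  by_contra! hx
  obtain ⟨z, hz, c, hzc, hle⟩ :=
    (upperSemicontinuous_upperEnvelope u).exists_touching_of_le_sphere hφ.continuous hr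
      (fun z hz => hu.1 z (hball hz)) hs hx
  obtain ⟨ρ, hρ, hsub⟩ := Metric.isOpen_iff.1 Metric.isOpen_ball z hz
  have h := hu.2 (fun y => φ y + c) z ρ (hφ.add contDiff_const).contDiffOn (hball hz) hρ
    (hsub.trans hball) (fun y hy => hle y (hsub hy)) hzc
  rw [gradient_add_const] at h
  exact (hgrad z).not_ge h

theorem IsEikonalSupersolution.le_of_le_sphere {n : ℕ} {Ω : Set (EuclideanSpace ℝ (Fin n))}
    {u : Ω → ℝ} (hu : IsEikonalSupersolution u) {φ : EuclideanSpace ℝ (Fin n) → ℝ}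
    (hφ : ContDiff ℝ 1 φ) {x : EuclideanSpace ℝ (Fin n)} {r : ℝ} (hr : 0 < r)
    (hball : Metric.ball x r ⊆ Ω) (hgrad : ∀ z, ‖gradient φ z‖ < 1)
    (hs : ∀ z ∈ Metric.sphere x r, (φ z : EReal) ≤ lowerEnvelope u z) :
    (φ x : EReal) ≤ lowerEnvelope u x := by
  by_contra! hx
  -- Touching from below is touching from above for `-u` and `-φ`.
  obtain ⟨z, hz, c, hzc, hle⟩ :=
    (upperSemicontinuous_upperEnvelope (fun y => -u y)).exists_touching_of_le_sphere
      (φ := fun y => -φ y) (x := x) hφ.continuous.neg hr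
      (fun z hz => by
        rw [upperEnvelope_neg, ← EReal.neg_bot, EReal.neg_lt_neg_iff]
        exact hu.1 z (hball hz))
      (fun z hz => by
        rw [upperEnvelope_neg, EReal.coe_neg, EReal.neg_le_neg_iff]
        exact hs z hz)
      (by rwa [upperEnvelope_neg, EReal.coe_neg, EReal.neg_lt_neg_iff])
  have hneg : ∀ y, ((-φ y + c : ℝ) : EReal) = -((φ y + -c : ℝ) : EReal) := fun y => by
    rw [← EReal.coe_neg]; congr 1; ring
  obtain ⟨ρ, hρ, hsub⟩ := Metric.isOpen_iff.1 Metric.isOpen_ball z hz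
  have h := hu.2 (fun y => φ y + -c) z ρ (hφ.add contDiff_const).contDiffOn (hball hz) hρ
    (hsub.trans hball)
    (fun y hy => by
      have := hle y (hsub hy)
      rwa [upperEnvelope_neg, hneg, EReal.neg_le_neg_iff] at this)
    (by rwa [upperEnvelope_neg, hneg, neg_inj] at hzc)
  rw [gradient_add_const] at h
  exact (hgrad z).not_ge h

/-- A ball is connected, so one meeting both `Ω` and its complement contains a frontier point. -/
theorem ball_subset_of_le_infEDist_frontier {E : Type*} [NormedAddCommGroup E] [NormedSpace ℝ E]
    {Ω : Set E} {x : E} (hx : x ∈ Ω) {r : ℝ}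
    (hr : ENNReal.ofReal r ≤ Metric.infEDist x (frontier Ω)) : Metric.ball x r ⊆ Ω := by
  intro z hz
  have hr0 : 0 < r := dist_nonneg.trans_lt hz
  by_contra hzΩ
  obtain ⟨w, hw, hwf⟩ := isPreconnected_closed_iff.1 (convex_ball x r).isPreconnected
    (closure Ω) (closure Ωᶜ) isClosed_closure isClosed_closure
    (fun y _ => (em (y ∈ Ω)).imp (subset_closure ·) (subset_closure ·))
    ⟨x, Metric.mem_ball_self hr0, subset_closure hx⟩ ⟨z, hz, subset_closure hzΩ⟩
  rw [← frontier_eq_closure_inter_closure] at hwf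
  have h1 : Metric.infEDist x (frontier Ω) ≤ edist x w := Metric.infEDist_le_edist_of_mem hwf
  have h2 : edist x w < ENNReal.ofReal r := by
    rw [edist_dist, ENNReal.ofReal_lt_ofReal_iff hr0, dist_comm]
    exact hw
  exact (h2.trans_le hr).not_ge h1

/-! ### Supersolutions: the smoothed cone -/

theorem boundaryDist_le_lowerEnvelope {n : ℕ} {Ω : Set (EuclideanSpace ℝ (Fin n))}
    {u : Ω → ℝ} (hu : IsEikonalSupersolution u) (h0 : ∀ x, 0 ≤ u x)
    {x : EuclideanSpace ℝ (Fin n)} (hx : x ∈ Ω) : boundaryDist Ω x ≤ lowerEnvelope u x := by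
  have hnn : ∀ z, 0 ≤ lowerEnvelope u z := fun z =>
    le_liminf_of_le (by isBoundedDefault) (Eventually.of_forall fun y => by exact_mod_cast h0 y)
  by_contra! hlt
  obtain ⟨R, hwR, hRd⟩ := EReal.lt_iff_exists_real_btwn.1 hlt
  have hR : 0 < R := by exact_mod_cast (hnn x).trans_lt hwR
  have hball : Metric.ball x R ⊆ Ω := by
    refine ball_subset_of_le_infEDist_frontier hx ?_
    rw [← EReal.coe_ennreal_le_coe_ennreal_iff, EReal.coe_ennreal_ofReal, max_eq_left hR.le]
    exact hRd.le
  have hfin : lowerEnvelope u x ≠ ⊤ := (hwR.trans (EReal.coe_lt_top R)).ne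
  have hbot : lowerEnvelope u x ≠ ⊥ := (hu.1 x hx).ne'
  lift lowerEnvelope u x to ℝ using ⟨hfin, hbot⟩ with w hw
  rw [EReal.coe_lt_coe_iff] at hwR
  have hw0 : 0 ≤ w := by
    have := hnn x
    rw [← hw] at this
    exact_mod_cast this
  -- The barrier `s - θ * √(δ² + ‖z - x‖²)` is at most `s - θ * R = 0` on the sphere, while at `x`
  -- it equals `s - θ * δ > s - δ = w`.
  obtain ⟨s, hws, hsR⟩ := exists_between hwR
  have hs0 : 0 < s := hw0.trans_lt hws
  set θ : ℝ := s / R with hθ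
  have hθ0 : 0 < θ := by positivity
  have hθ1 : θ < 1 := (div_lt_one hR).2 hsR
  set δ : ℝ := s - w with hδ
  have hδ0 : 0 < δ := by linarith
  let q : EuclideanSpace ℝ (Fin n) → ℝ := fun z => √(δ ^ 2 + ‖z - x‖ ^ 2)
  have hqpos : ∀ z, 0 < δ ^ 2 + ‖z - x‖ ^ 2 := fun z => by positivity
  have hφ : ContDiff ℝ 1 (fun z => s - θ * q z) := by
    refine contDiff_const.sub (contDiff_const.mul (ContDiff.sqrt ?_ fun z => (hqpos z).ne'))
    exact contDiff_const.add ((contDiff_id.sub contDiff_const).norm_sq ℝ)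
  have hgrad : ∀ z, ‖gradient (fun z => s - θ * q z) z‖ < 1 := by
    intro z
    have hlip : LipschitzWith ⟨θ, hθ0.le⟩ (fun z => s - θ * q z) := by
      refine LipschitzWith.of_le_add_mul _ fun a b => ?_
      have h1 : q b ≤ q a + dist a b := by
        refine Real.sqrt_le_iff.2 ⟨by positivity, ?_⟩
        have ha : q a ^ 2 = δ ^ 2 + ‖a - x‖ ^ 2 := Real.sq_sqrt (hqpos a).le
        have hqa : ‖a - x‖ ≤ q a := Real.le_sqrt_of_sq_le (by nlinarith)
        have htri : ‖b - x‖ ≤ ‖a - x‖ + dist a b := by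
          have := dist_triangle b a x
          rw [dist_comm b a] at this
          simp only [dist_eq_norm] at this ⊢
          linarith
        have h0 : 0 ≤ dist a b := dist_nonneg
        nlinarith [norm_nonneg (b - x), norm_nonneg (a - x)]
      change s - θ * q a ≤ s - θ * q b + θ * dist a b
      nlinarith
    have h := norm_fderiv_le_of_lipschitz ℝ hlip (x₀ := z)
    rw [gradient, LinearIsometryEquiv.norm_map]
    exact lt_of_le_of_lt h hθ1
  have key := hu.le_of_le_sphere hφ hR hball hgrad fun z hz => ?_
  · rw [← hw, EReal.coe_le_coe_iff] at key
    have hqx : q x = δ := by simp [q, Real.sqrt_sq hδ0.le]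
    rw [hqx] at key
    nlinarith
  · refine le_trans ?_ (hnn z)
    have hqz : R ≤ q z := by
      rw [mem_sphere_iff_norm] at hz
      refine Real.le_sqrt_of_sq_le ?_
      rw [hz]
      nlinarith
    have : s = θ * R := by rw [hθ]; field_simp
    have : s - θ * q z ≤ 0 := by nlinarith
    exact_mod_cast this

/-! ### Subsolutions: the tube barrier -/

/-- A linear function of slope `θ` pointing from `y` in the direction `-e`, with a penalty
away from the segment from `y` to `y - d • e`. -/
noncomputable def tubeBarrier {E : Type*} [NormedAddCommGroup E] [InnerProductSpace ℝ E]
    (y e : E) (d θ K : ℝ) (z : E) : ℝ :=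
  θ * inner ℝ (y - z) e + K * (‖y - z‖ ^ 2 - inner ℝ (y - z) e ^ 2 +
    Real.smoothTransition (2 * (inner ℝ (y - z) e - d) / d))

theorem contDiff_tubeBarrier {E : Type*} [NormedAddCommGroup E] [InnerProductSpace ℝ E]
    (y e : E) (d θ K : ℝ) : ContDiff ℝ 1 (tubeBarrier y e d θ K) := by
  have hi : ContDiff ℝ 1 (fun z : E => inner ℝ (y - z) e) :=
    (contDiff_const.sub contDiff_id).inner ℝ contDiff_const
  have hn : ContDiff ℝ 1 (fun z : E => ‖y - z‖ ^ 2) :=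
    (contDiff_const.sub contDiff_id).norm_sq ℝ
  have ht : ContDiff ℝ 1
      (fun z : E => Real.smoothTransition (2 * (inner ℝ (y - z) e - d) / d)) :=
    (Real.smoothTransition.contDiff (n := 1)).comp
      ((contDiff_const.mul (hi.sub contDiff_const)).div_const d)
  exact (contDiff_const.mul hi).add (contDiff_const.mul ((hn.sub (hi.pow 2)).add ht))

/-- The term `‖y - z‖² - ⟪y - z, e⟫²` is the squared distance to the axis, constant along `e`; the
transition term is monotone in `⟪y - z, e⟫`, which decreases along `e`. -/
theorem tubeBarrier_add_smul_add_le {E : Type*} [NormedAddCommGroup E] [InnerProductSpace ℝ E]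
    (y e : E) (he : ‖e‖ = 1) {d K : ℝ} (θ : ℝ) (hd : 0 < d) (hK : 0 ≤ K) (z : E) {t : ℝ}
    (ht : 0 ≤ t) :
    tubeBarrier y e d θ K (z + t • e) + θ * t ≤ tubeBarrier y e d θ K z := by
  have h1 : inner ℝ (y - (z + t • e)) e = inner ℝ (y - z) e - t := by
    rw [← sub_sub, inner_sub_left, real_inner_smul_left, real_inner_self_eq_norm_sq, he]
    ring
  have h2 : ‖y - (z + t • e)‖ ^ 2 = ‖y - z‖ ^ 2 - 2 * t * inner ℝ (y - z) e + t ^ 2 := by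
    rw [← sub_sub, norm_sub_sq_real, real_inner_smul_right, norm_smul, he, Real.norm_eq_abs,
      mul_one, sq_abs]
    ring
  have h3 : Real.smoothTransition (2 * (inner ℝ (y - z) e - t - d) / d) ≤
      Real.smoothTransition (2 * (inner ℝ (y - z) e - d) / d) := by
    apply Real.smoothTransition.monotone
    gcongr
    linarith
  simp only [tubeBarrier, h1, h2]
  nlinarith [mul_le_mul_of_nonneg_left h3 hK]

theorem le_norm_gradient_tubeBarrier {E : Type*} [NormedAddCommGroup E] [InnerProductSpace ℝ E]
    [CompleteSpace E] (y e : E) (he : ‖e‖ = 1) {d K : ℝ} (θ : ℝ) (hd : 0 < d) (hK : 0 ≤ K)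
    (z : E) : θ ≤ ‖gradient (tubeBarrier y e d θ K) z‖ := by
  set L := fderiv ℝ (tubeBarrier y e d θ K) z
  have hL : HasFDerivAt (tubeBarrier y e d θ K) L z :=
    ((contDiff_tubeBarrier y e d θ K).differentiable one_ne_zero z).hasFDerivAt
  have hline : HasDerivAt (fun t : ℝ => tubeBarrier y e d θ K (z + t • e)) (L e) 0 :=
    hL.hasLineDerivAt e
  have hle : L e ≤ -θ := by
    have hslope := (hasDerivWithinAt_iff_tendsto_slope' (s := Set.Ioi (0 : ℝ)) (by simp)).1
      (hline.hasDerivWithinAt (s := Set.Ioi 0))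
    refine le_of_tendsto hslope ?_
    filter_upwards [self_mem_nhdsWithin] with t ht
    have ht : 0 < t := ht
    have := tubeBarrier_add_smul_add_le y e he θ hd hK z ht.le
    rw [slope_def_field, zero_smul, add_zero, sub_zero, div_le_iff₀ ht]
    linarith
  have h1 : |L e| ≤ ‖L‖ := by
    have := L.le_opNorm e
    rwa [he, mul_one] at this
  rw [gradient, LinearIsometryEquiv.norm_map]
  linarith [neg_abs_le (L e)]

/-- On the sphere of radius `d` centred at `y - d • e`, the barrier is nonnegative, and it is large
away from `y`. -/
theorem tubeBarrier_sphere {E : Type*} [NormedAddCommGroup E] [InnerProductSpace ℝ E]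
    {y e : E} (he : ‖e‖ = 1) {d θ K : ℝ} (hd : 0 < d) (hθ : 0 ≤ θ) (hK : 0 ≤ K) {z : E}
    (hz : z ∈ Metric.sphere (y - d • e) d) :
    0 ≤ tubeBarrier y e d θ K z ∧
      K * min 1 (‖y - z‖ ^ 2 / 4) ≤ tubeBarrier y e d θ K z := by
  set τ : ℝ := inner ℝ (y - z) e with hτ
  have hnorm : ‖y - z‖ ^ 2 = 2 * d * τ := by
    have h : ‖(y - z) - d • e‖ ^ 2 = d ^ 2 := by
      rw [mem_sphere_iff_norm, ← norm_neg] at hz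
      rw [show y - z - d • e = -(z - (y - d • e)) by abel, hz]
    rw [norm_sub_sq_real, real_inner_smul_right, norm_smul, he, Real.norm_eq_abs, mul_one,
      sq_abs] at h
    linarith
  have hτ0 : 0 ≤ τ := by
    by_contra! h
    nlinarith [sq_nonneg ‖y - z‖]
  have hcs : 0 ≤ ‖y - z‖ ^ 2 - τ ^ 2 := by
    have := abs_real_inner_le_norm (y - z) e
    rw [he, mul_one, ← hτ, abs_of_nonneg hτ0] at this
    nlinarith
  have hst : 0 ≤ Real.smoothTransition (2 * (τ - d) / d) := Real.smoothTransition.nonneg _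
  have hθτ : 0 ≤ θ * τ := mul_nonneg hθ hτ0
  have hmin : min 1 (‖y - z‖ ^ 2 / 4) ≤
      ‖y - z‖ ^ 2 - τ ^ 2 + Real.smoothTransition (2 * (τ - d) / d) := by
    -- Near the antipode of `y` the transition equals 1. Elsewhere `‖y - z‖² = 2dτ` gives `‖y - z‖²
    -- - τ² = ‖y - z‖² (1 - τ / (2d)) ≥ ‖y - z‖² / 4`.
    rcases le_total (3 * d / 2) τ with h | h
    · rw [Real.smoothTransition.one_of_one_le (by rw [le_div_iff₀ hd]; linarith)]
      exact (min_le_left _ _).trans (by linarith)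
    · refine (min_le_right _ _).trans ?_
      nlinarith
  have hle : K * min 1 (‖y - z‖ ^ 2 / 4) ≤ tubeBarrier y e d θ K z := by
    have := mul_le_mul_of_nonneg_left hmin hK
    simp only [tubeBarrier, ← hτ]
    linarith
  exact ⟨le_trans (by positivity) hle, hle⟩

theorem upperEnvelope_le_boundaryDist {n : ℕ} {Ω : Set (EuclideanSpace ℝ (Fin n))}
    (hΩ : IsOpen Ω) {u : Ω → ℝ} (hu : IsEikonalSubsolution u)
    (h0 : ∀ y ∈ frontier Ω, upperEnvelope u y ≤ 0)
    {x : EuclideanSpace ℝ (Fin n)} (hx : x ∈ Ω) : upperEnvelope u x ≤ boundaryDist Ω x := by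
  rcases (frontier Ω).eq_empty_or_nonempty with hemp | hne
  · simp [boundaryDist, hemp]
  obtain ⟨y, hy, hxy⟩ := isClosed_frontier.exists_infDist_eq_dist hne x
  set d : ℝ := dist x y with hdxy
  have hinf : Metric.infEDist x (frontier Ω) = ENNReal.ofReal d := by
    rw [← hxy, Metric.infDist, ENNReal.ofReal_toReal (Metric.infEDist_ne_top hne)]
  have hd : 0 < d := by
    refine dist_pos.2 ?_
    rintro rfl
    exact (hΩ.inter_frontier_eq ▸ ⟨hx, hy⟩ : x ∈ (∅ : Set _))
  have hball : Metric.ball x d ⊆ Ω := ball_subset_of_le_infEDist_frontier hx hinf.ge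
  have hclosed : Metric.closedBall x d ⊆ closure Ω := by
    rw [← closure_ball x hd.ne']
    exact closure_mono hball
  have husc := upperSemicontinuous_upperEnvelope u
  have hfin : ∀ z ∈ Metric.closedBall x d, upperEnvelope u z < ⊤ := by
    intro z hz
    by_cases hzΩ : z ∈ Ω
    · exact hu.1 z hzΩ
    -- The sphere may meet the frontier at points other than `y`; there the boundary condition gives
    -- finiteness.
    · exact (h0 z ⟨hclosed hz, by rwa [hΩ.interior_eq]⟩).trans_lt EReal.zero_lt_top
  obtain ⟨M, hM0, hM⟩ : ∃ M : ℝ, 0 ≤ M ∧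
      ∀ z ∈ Metric.closedBall x d, upperEnvelope u z ≤ (M : EReal) := by
    obtain ⟨z, hz, hmax⟩ := (husc.upperSemicontinuousOn (Metric.closedBall x d)).exists_isMaxOn
      ⟨x, Metric.mem_closedBall_self hd.le⟩ (isCompact_closedBall x d)
    refine ⟨max 0 (upperEnvelope u z).toReal, le_max_left _ _, fun w hw => (hmax hw).trans ?_⟩
    exact (EReal.le_coe_toReal (hfin z hz).ne).trans (EReal.coe_le_coe_iff.2 (le_max_right _ _))
  have hbd : boundaryDist Ω x = (d : EReal) := by
    rw [boundaryDist, hinf, EReal.coe_ennreal_ofReal, max_eq_left hd.le]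
  rw [hbd]
  refine EReal.le_of_forall_lt_iff_le.1 fun a ha => ?_
  rw [EReal.coe_lt_coe_iff] at ha
  -- With `θ = 1 + ε / d`, the barrier raised by `ε` takes the value `θ * d + ε = d + 2 * ε = a` at
  -- `x`.
  set ε : ℝ := (a - d) / 2 with hε
  have hε0 : 0 < ε := by rw [hε]; linarith
  set θ : ℝ := 1 + ε / d with hθ
  have hθ1 : 1 < θ := by
    have : 0 < ε / d := by positivity
    linarith
  obtain ⟨η, hη, hnear⟩ : ∃ η > 0, ∀ z ∈ Metric.ball y η, upperEnvelope u z < (ε : EReal) :=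
    Metric.eventually_nhds_iff_ball.1
      (husc y ε ((h0 y hy).trans_lt (by exact_mod_cast hε0)))
  set c : ℝ := min 1 (η ^ 2 / 4) with hc
  have hc0 : 0 < c := lt_min one_pos (by positivity)
  -- On the sphere outside `ball y η` the barrier is at least `K * c = M`.
  set K : ℝ := M / c with hKdef
  have hK : 0 ≤ K := by positivity
  set e : EuclideanSpace ℝ (Fin n) := d⁻¹ • (y - x) with he_def
  have hnyx : ‖y - x‖ = d := by rw [hdxy, dist_comm, dist_eq_norm]
  have he : ‖e‖ = 1 := by
    rw [he_def, norm_smul, hnyx, norm_inv, Real.norm_of_nonneg hd.le, inv_mul_cancel₀ hd.ne']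
  have hde : d • e = y - x := by rw [he_def, smul_inv_smul₀ hd.ne']
  have hcenter : y - d • e = x := by rw [hde, sub_sub_cancel]
  have key := hu.le_of_le_sphere (φ := fun z => tubeBarrier y e d θ K z + ε)
    ((contDiff_tubeBarrier y e d θ K).add contDiff_const) hd hball
    (fun z => by
      rw [gradient_add_const]
      exact hθ1.trans_le (le_norm_gradient_tubeBarrier y e he θ hd hK z))
    (fun z hz => by
      have hz' : z ∈ Metric.sphere (y - d • e) d := by rwa [hcenter]
      obtain ⟨hb0, hbK⟩ := tubeBarrier_sphere he hd (by linarith : 0 ≤ θ) hK hz'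
      by_cases hzy : z ∈ Metric.ball y η
      · exact (hnear z hzy).le.trans (EReal.coe_le_coe_iff.2 (by linarith))
      · refine (hM z (Metric.sphere_subset_closedBall hz)).trans (EReal.coe_le_coe_iff.2 ?_)
        rw [Metric.mem_ball, not_lt, dist_comm, dist_eq_norm] at hzy
        have hcz : c ≤ min 1 (‖y - z‖ ^ 2 / 4) := by
          rw [hc]
          gcongr
        have hKc : K * c = M := div_mul_cancel₀ M hc0.ne'
        nlinarith [mul_le_mul_of_nonneg_left hcz hK])
  have hval : tubeBarrier y e d θ K x + ε = a := by
    have hin : inner ℝ (y - x) e = d := by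
      rw [← hde, real_inner_smul_left, real_inner_self_eq_norm_sq, he]
      ring
    rw [tubeBarrier, hin, hnyx, sub_self, sub_self, mul_zero, zero_div,
      Real.smoothTransition.zero, hθ, hε]
    field_simp
    ring
  rwa [hval] at key

theorem lemma3p7 (n : ℕ) (Ω : Set (EuclideanSpace ℝ (Fin n))) (hΩ : IsOpen Ω) (u : Ω → ℝ) :
    (IsEikonalSubsolution u → (∀ y ∈ frontier Ω, upperEnvelope u y ≤ 0) →
      ∀ x ∈ Ω, upperEnvelope u x ≤ boundaryDist Ω x) ∧
    (IsEikonalSupersolution u → (∀ x : Ω, 0 ≤ u x) →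
      ∀ x ∈ Ω, boundaryDist Ω x ≤ lowerEnvelope u x) :=
  ⟨fun hu h0 _ hx => upperEnvelope_le_boundaryDist hΩ hu h0 hx,
    fun hu h0 _ hx => boundaryDist_le_lowerEnvelope hu h0 hx⟩
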